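/- Consider an asynchronous message-passing system with a set $\mathcal S$ of $n$ servers, an infinite (countable) set $\Pi$ of clients disjoint from $\mathcal S$, and reliable links between all processes. Each process runs a deterministic local algorithm without access to a clock; at most $f$ servers and any number of clients may crash, where $1\le f<n$. A process is correct if it does not crash. Processes are sequential: none invokes an operation before its previous one has returned. A change is a quadruple $\langle p,\mathit{lc},s,\Delta\rangle\in(\mathcal S\cup\Pi)\times\mathbb N\times\mathcal S\times\mathbb R$. Every process can invoke $\mathtt{read\_changes}(s)$ for $s\in\mathcal S$, which returns a set of changes; every server can invoke $\mathtt{reassign}(s,\Delta)$ for $s\in\mathcal S$ and $\Delta\in\mathbb R\setminus\{0\}$. An invocation $\mathtt{reassign}(s,\Delta)$ made by a server $s_i$ with local counter $\mathit{lc}_i$ is completed at some time $\tau$, not before the invocation, such that the response of every invocation of $\mathtt{read\_changes}(s)$ made from time $\tau$ on contains a change $\langle s_i,\mathit{lc}_i,s,*\rangle$. When it is completed, a change $c=\langle s_i,\mathit{lc}_i,s,\Delta'\rangle$ is created, and the message $\langle\mathtt{Complete},c\rangle$ is then returned to $s_i$. The local counter of a server is $2$ at its first invocation of $\mathtt{reassign}$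 and is incremented after each such invocation. Let $w:\mathcal S\to\mathbb R$ be the initial weights, let $\mathcal C_{s,t}$ be the set consisting of the change $\langle s,1,s,w(s)\rangle$ and of all changes created for $s$ by invocations completed at or before time $t\ge 0$, and put $W_{s,t}=\sum_{\langle *,*,s,\Delta\rangle\in\mathcal C_{s,t}}\Delta$ and $W_{A,t}=\sum_{s\in A}W_{s,t}$ for $A\subseteq\mathcal S$. An algorithm solves the weight reassignment problem with initial weights $w$ if in each of its executions completion times and created changes as above can be assigned to the invocations of $\mathtt{reassign}$ (an invocation of a crashed server may stay incomplete) such that: - Integrity: $W_{F,t}<W_{\mathcal S,t}/2$ for all $t\ge 0$ and all $F\subset\mathcal S$ with $|F|=f$. - Validity-I: the change created when $\mathtt{reassign}(s,\Delta)$ is completed has weight $\Delta$ if Integrity is not violated at that time with this weight, and weight $0$ otherwise. - Validity-II: if $\mathtt{read\_changes}(s)$ is invoked at time $t$, then its response contains $\mathcal C_{s,t}$. - Liveness: every invocation of $\mathtt{reassign}$ by a correct server is eventually completed and returns a message $\langle\mathtt{Complete},*\rangle$, and every invocation of $\mathtt{read\_changes}$ by a correct process eventually returns a set of changes. Theorem.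 For all $1\le f<n$ and all initial weights $w:\mathcal S\to\mathbb R$ that satisfy Integrity (i.e. $\sum_{s\in F}w(s)<\frac12\sum_{s\in\mathcal S}w(s)$ for all $F\subset\mathcal S$ with $|F|=f$), no algorithm solves the weight reassignment problem with initial weights $w$. -/

import Mathlib

universe u v

noncomputable section

namespace WeightReassignment

/-! ### Processes, operations and responses -/

/-- The processes: `n` servers and infinitely many clients, two disjoint sets. -/
abbrev Proc (n : ℕ) : Type := Fin n ⊕ ℕ

/-- A change `⟨p, lc, s, Δ⟩`: the weight of server `s` is changed by `Δ` as the outcome of a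
request made by process `p` when its local counter was `lc`. -/
structure Change (n : ℕ) where
  issuer : Proc n
  counter : ℕ
  target : Fin n
  weight : ℝ

/-- The two operations of the problem. -/
inductive Op (n : ℕ) where
  | reassign (s : Fin n) (Δ : ℝ)
  | readChanges (s : Fin n)

/-- The responses: a message `⟨Complete, c⟩`, or a set of changes. -/
inductive Response (n : ℕ) where
  | complete (c : Change n)
  | changes (C : Set (Change n))

/-! ### Asynchronous message-passing algorithms -/

/-- What a process may be given in one of its steps: an invocation by its user, a message
received from another process, or nothing. -/
inductive Input (n : ℕ) (M : Type v) where
  | invoke (o : Op n)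
  | receive (q : Proc n) (m : M)
  | idle

/-- A (deterministic) message-passing algorithm: a local automaton for each process. In one atomic
step a process consumes an input, changes its local state, sends any finite number of messages to
each process, and may return a response to its user. The local steps have no access to a clock. -/
structure Algorithm (n : ℕ) where
  State : Type u
  Msg : Type v
  init : Proc n → State
  next : Proc n → State → Input n Msg → State
  send : Proc n → State → Input n Msg → Proc n → Multiset Msg
  respond : Proc n → State → Input n Msg → Option (Response n)

variable {n : ℕ}

/-- A global configuration: the local states, and for each process the messages in transit to it,
together with their senders. -/
structure Config (A : Algorithm.{u, v} n) where
  state : Proc n → A.State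
  buffer : Proc n → Multiset (Proc n × A.Msg)

/-- The initial configuration: initial local states, no message in transit. -/
def Config.initial (A : Algorithm.{u, v} n) : Config A where
  state := A.init
  buffer := fun _ => 0

/-- A step of process `p` with input `x` is possible: a message can only be received while it is
in transit to `p`. -/
def Config.Enabled {A : Algorithm.{u, v} n} (c : Config A) (p : Proc n) :
    Input n A.Msg → Prop
  | .receive q m => (q, m) ∈ c.buffer p
  | _ => True

open Classical in
/-- The messages in transit to `p` once `p` has consumed the input `x`. -/
def Config.remaining {A : Algorithm.{u, v} n} (c : Config A) (p : Proc n) :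
    Input n A.Msg → Multiset (Proc n × A.Msg)
  | .receive q m => (c.buffer p).erase (q, m)
  | _ => c.buffer p

open Classical in
/-- The configuration after a step of process `p` with input `x`. -/
def Config.step {A : Algorithm.{u, v} n} (c : Config A) (p : Proc n) (x : Input n A.Msg) :
    Config A where
  state := Function.update c.state p (A.next p (c.state p) x)
  buffer := fun r =>
    (if r = p then c.remaining p x else c.buffer r) +
      (A.send p (c.state p) x r).map (fun m => (p, m))

/-- An infinite execution: an interleaving of steps, the `k`-th of which is taken by the process
`actor k` with input `input k`. -/
structure Execution (A : Algorithm.{u, v} n) where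
  actor : ℕ → Proc n
  input : ℕ → Input n A.Msg
  config : ℕ → Config A
  config_zero : config 0 = Config.initial A
  enabled : ∀ k, (config k).Enabled (actor k) (input k)
  config_succ : ∀ k, config (k + 1) = (config k).step (actor k) (input k)

namespace Execution

variable {A : Algorithm.{u, v} n} (E : Execution A)

/-- The response, if any, that is returned in the `k`-th step. -/
def output (k : ℕ) : Option (Response n) :=
  A.respond (E.actor k) ((E.config k).state (E.actor k)) (E.input k)

/-- Process `p` invokes the operation `o` in the `k`-th step. -/
def Invokes (k : ℕ) (p : Proc n) (o : Op n) : Prop :=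
  E.actor k = p ∧ E.input k = .invoke o

/-- The operation that is invoked in step `j` receives the response `r` in step `k`: this is the
first response that its invoker returns from step `j` on. -/
def RespondsAt (j k : ℕ) (r : Response n) : Prop :=
  j ≤ k ∧ E.actor k = E.actor j ∧ E.output k = some r ∧
    ∀ i, j ≤ i → i < k → E.actor i = E.actor j → E.output i = none

/-- A process is correct if it never crashes, that is, if it takes infinitely many steps. -/
def Correct (p : Proc n) : Prop := ∀ k, ∃ k', k ≤ k' ∧ E.actor k' = p

/-- At most `f` servers crash (and any number of clients), and the links are reliable: every
message in transit to a correct process is eventually received. By construction of the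
configurations, messages are neither created, altered nor duplicated by the links. -/
structure Admissible (f : ℕ) : Prop where
  crashes : {s : Fin n | ¬ E.Correct (.inl s)}.ncard ≤ f
  reliable : ∀ p, E.Correct p → ∀ k q m, (q, m) ∈ (E.config k).buffer p →
    ∃ k', k ≤ k' ∧ E.actor k' = p ∧ E.input k' = .receive q m

/-- The rules for the users: a process invokes no operation before obtaining the response to its
previous one, only servers invoke `reassign`, and they never do so with the value zero. -/
structure WellFormed : Prop where
  sequential : ∀ j k p o o', j < k → E.Invokes j p o → E.Invokes k p o' →
    ∃ i, j ≤ i ∧ i < k ∧ E.actor i = p ∧ E.output i ≠ none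
  servers_only : ∀ k p s Δ, E.Invokes k p (.reassign s Δ) → ∃ i : Fin n, p = .inl i
  ne_zero : ∀ k p s Δ, E.Invokes k p (.reassign s Δ) → Δ ≠ 0

/-- The reading of the global clock when the `k`-th step is taken; time `0` precedes all steps. -/
def time (_E : Execution A) (k : ℕ) : ℝ := k + 1

open Classical in
/-- The local counter of `actor k` in step `k`. It is `1` for the change that defines the initial
weight of a server, so `2` at its first invocation of `reassign`, and it is incremented after each
invocation of `reassign`. -/
def counter (k : ℕ) : ℕ :=
  2 + {i ∈ Finset.range k | E.actor i = E.actor k ∧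
    ∃ s Δ, E.input i = .invoke (.reassign s Δ)}.card

/-- From time `τ` on, the response of every invocation of `readChanges(s)` contains a change
`⟨p, lc, s, *⟩`. -/
def CompletedFrom (p : Proc n) (lc : ℕ) (s : Fin n) (τ : ℝ) : Prop :=
  ∀ j q, E.Invokes j q (.readChanges s) → τ ≤ E.time j → ∀ k r, E.RespondsAt j k r →
    ∃ C, r = .changes C ∧ ∃ x : ℝ, (⟨p, lc, s, x⟩ : Change n) ∈ C

end Execution

/-! ### The weight reassignment problem -/

/-- The fates of the invocations of `reassign` in an execution: the invocation made in step `k` is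
completed at time `completion k` (`⊤` if it is never completed), and the change that is then
created has weight `weight k`. -/
structure Outcome where
  completion : ℕ → WithTop ℝ
  weight : ℕ → ℝ

/-- Any `f` servers have less than half of the total weight. -/
def IntegrityHolds (f : ℕ) (W : Fin n → ℝ) : Prop :=
  ∀ F : Finset (Fin n), F.card = f → ∑ s ∈ F, W s < (∑ s, W s) / 2

variable {A : Algorithm.{u, v} n}

/-- The set `C_{s,t}` of the changes created for `s` by the invocations of `reassign` that are
completed at time `t ≥ 0`; the change that defines the initial weight `w s` is one of them. -/
def completedChanges (E : Execution A) (w : Fin n → ℝ) (X : Outcome) (s : Fin n) (t : ℝ) :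
    Set (Change n) :=
  {c | c = ⟨.inl s, 1, s, w s⟩ ∨
    ∃ k p Δ, E.Invokes k p (.reassign s Δ) ∧ X.completion k ≤ (t : WithTop ℝ) ∧
      c = ⟨p, E.counter k, s, X.weight k⟩}

/-- The weight `W_{s,t}` of server `s` at time `t ≥ 0`. -/
def weightAt (E : Execution A) (w : Fin n → ℝ) (X : Outcome) (t : ℝ) (s : Fin n) : ℝ :=
  ∑ᶠ c ∈ completedChanges E w X s t, c.weight

open Classical in
/-- The requirements of the weight reassignment problem on an execution with initial weights `w`
and at most `f` crashes among the servers, for given completion times and created changes. -/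
structure MeetsSpec (E : Execution A) (f : ℕ) (w : Fin n → ℝ) (X : Outcome) : Prop where
  /-- An invocation is not completed before it is made. -/
  after_invocation : ∀ k p s Δ, E.Invokes k p (.reassign s Δ) →
    (E.time k : WithTop ℝ) ≤ X.completion k
  /-- A completion time is a time from which on all responses to `readChanges` show a change. -/
  completed : ∀ k p s Δ, E.Invokes k p (.reassign s Δ) → ∀ τ : ℝ, X.completion k = τ →
    E.CompletedFrom p (E.counter k) s τ
  /-- What `reassign` returns is `⟨Complete, c⟩`, with `c` the change that has been created upon
  completion. -/
  complete_message : ∀ k p s Δ, E.Invokes k p (.reassign s Δ) → ∀ j r, E.RespondsAt k j r →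
    X.completion k ≤ (E.time j : WithTop ℝ) ∧
      r = .complete ⟨p, E.counter k, s, X.weight k⟩
  integrity : ∀ t : ℝ, 0 ≤ t → IntegrityHolds f (weightAt E w X t)
  /-- The created change has weight `Δ` if with that weight Integrity is not violated at the time
  of completion, and has weight `0` otherwise. -/
  validity_one : ∀ k p s Δ, E.Invokes k p (.reassign s Δ) → ∀ τ : ℝ, X.completion k = τ →
    X.weight k =
      if IntegrityHolds f (Function.update (weightAt E w X τ) s
          (weightAt E w X τ s - X.weight k + Δ)) then Δ else 0
  validity_two : ∀ k p s, E.Invokes k p (.readChanges s) → ∀ j r, E.RespondsAt k j r →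
    ∃ C, r = .changes C ∧ completedChanges E w X s (E.time k) ⊆ C
  liveness_reassign : ∀ k p s Δ, E.Invokes k p (.reassign s Δ) → E.Correct p →
    X.completion k ≠ ⊤ ∧ ∃ j c, E.RespondsAt k j (.complete c)
  liveness_read : ∀ k p s, E.Invokes k p (.readChanges s) → E.Correct p →
    ∃ j C, E.RespondsAt k j (.changes C)

/-- `A` solves the weight reassignment problem for the initial weights `w` in the asynchronous
system in which at most `f` servers and any number of clients may crash. -/
def Solves (A : Algorithm.{u, v} n) (f : ℕ) (w : Fin n → ℝ) : Prop :=
  ∀ E : Execution A, E.WellFormed → E.Admissible f → ∃ X : Outcome, MeetsSpec E f w X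

end WeightReassignment

end

/-! Two competing weight increases amount to consensus, which is impossible in an asynchronous
system where one process may crash. By `exists_increase`, every server `s` admits an increment `Δ`
that Integrity allows once but not twice. Let two servers `p₀` and `p₁` (they exist since `1 ≤ f <
n`) request `reassign(s, Δ)` at most once each, with no other invocations and all clients silent. If
both requests complete, Validity-I makes exactly one of the created changes nonzero
(`weight_ne_zero_iff`); if only one request is ever made and it completes, its change has weight `Δ`
(`weight_eq_of_forall_invokes`). Hence a single returned change already reveals the winner.

The winner is thus a decision in the sense of Fischer, Lynch and Paterson: it is irrevocable and
unique, either competitor can win from the initial configuration, and since `f ≥ 1` it is reached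
even if one server crashes. `fischer_lynch_paterson` refutes this for abstract systems of local,
commuting events by the classical bivalence argument. Invocations are themselves scheduled events,
so a single initial configuration is bivalent. `not_solves` applies the theorem to `oneShot`, whose
runs that are fair to all but at most one server are admissible executions
(`runExecution_admissible`). -/

namespace WeightReassignment

/-! ### Asynchronous event systems -/

/-- A transition system whose events are local to processes: an enabled event stays enabled until
it occurs, and enabled events of distinct processes commute. -/
structure EventSystem (P Ev Conf : Type*) where
  proc : Ev → P
  Enabled : Conf → Ev → Prop
  apply : Conf → Ev → Conf
  persist : ∀ {C e e'}, Enabled C e → Enabled C e' → e ≠ e' → Enabled (apply C e') e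
  comm : ∀ {C e e'}, proc e ≠ proc e' → Enabled C e → Enabled C e' →
    apply (apply C e) e' = apply (apply C e') e
  -- Countability lets one run serve every enabled event; the next field keeps schedules from
  -- getting stuck.
  countable : ∀ C, {e | Enabled C e}.Countable
  exists_enabled : ∀ C p, ∃ e, proc e = p ∧ Enabled C e

namespace EventSystem

variable {P Ev Conf : Type*} (T : EventSystem P Ev Conf)

/-- The configuration reached by a finite schedule. -/
def exec (C : Conf) (σ : List Ev) : Conf := σ.foldl T.apply C

/-- A finite schedule is applicable to a configuration. -/
def Valid : Conf → List Ev → Prop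
  | _, [] => True
  | C, e :: σ => T.Enabled C e ∧ Valid (T.apply C e) σ

@[simp] theorem exec_nil (C : Conf) : T.exec C [] = C := rfl

@[simp] theorem exec_cons (C : Conf) (e : Ev) (σ : List Ev) :
    T.exec C (e :: σ) = T.exec (T.apply C e) σ := rfl

@[simp] theorem exec_append (C : Conf) (σ τ : List Ev) :
    T.exec C (σ ++ τ) = T.exec (T.exec C σ) τ := List.foldl_append

@[simp] theorem valid_nil (C : Conf) : T.Valid C [] := trivial

@[simp] theorem valid_cons (C : Conf) (e : Ev) (σ : List Ev) :
    T.Valid C (e :: σ) ↔ T.Enabled C e ∧ T.Valid (T.apply C e) σ := Iff.rfl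

@[simp] theorem valid_append (C : Conf) (σ τ : List Ev) :
    T.Valid C (σ ++ τ) ↔ T.Valid C σ ∧ T.Valid (T.exec C σ) τ := by
  induction σ generalizing C with
  | nil => simp
  | cons e σ ih => simp [ih, and_assoc]

variable {T}

/-- An event commutes with a schedule in which its process takes no step. -/
theorem Valid.comm {C : Conf} {e : Ev} (he : T.Enabled C e) {σ : List Ev} (hσ : T.Valid C σ)
    (hp : ∀ x ∈ σ, T.proc x ≠ T.proc e) :
    T.Valid (T.apply C e) σ ∧ T.Enabled (T.exec C σ) e ∧
      T.exec (T.apply C e) σ = T.apply (T.exec C σ) e := by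
  induction σ generalizing C with
  | nil => exact ⟨trivial, he, rfl⟩
  | cons x σ ih =>
    have hx : T.proc x ≠ T.proc e := hp x (by simp)
    have hne : x ≠ e := fun h => hx (by rw [h])
    have hc := T.comm hx hσ.1 he
    obtain ⟨h1, h2, h3⟩ := ih (T.persist he hσ.1 hne.symm) hσ.2
      fun y hy => hp y (List.mem_cons_of_mem _ hy)
    rw [hc] at h1 h3
    exact ⟨⟨T.persist hσ.1 he hne, h1⟩, h2, h3⟩

/-! ### Infinite schedules and fairness -/

variable (T)

/-- The configuration before the `k`-th event of an infinite schedule. -/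
def conf (C : Conf) (ev : ℕ → Ev) : ℕ → Conf
  | 0 => C
  | k + 1 => T.apply (conf C ev k) (ev k)

/-- An infinite schedule is applicable to a configuration. -/
def IsRun (C : Conf) (ev : ℕ → Ev) : Prop := ∀ k, T.Enabled (T.conf C ev k) (ev k)

/-- From some time on only the processes in `Q` take steps, and all their enabled events occur. -/
structure Fair (C : Conf) (ev : ℕ → Ev) (Q : Set P) : Prop where
  occurs : ∀ k e, T.proc e ∈ Q → T.Enabled (T.conf C ev k) e → ∃ k', k ≤ k' ∧ ev k' = e
  eventually_mem : ∃ N, ∀ k, N ≤ k → T.proc (ev k) ∈ Q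

@[simp] theorem conf_zero (C : Conf) (ev : ℕ → Ev) : T.conf C ev 0 = C := rfl

theorem conf_succ (C : Conf) (ev : ℕ → Ev) (k : ℕ) :
    T.conf C ev (k + 1) = T.apply (T.conf C ev k) (ev k) := rfl

theorem exec_map_range (C : Conf) (ev : ℕ → Ev) (k : ℕ) :
    T.exec C ((List.range k).map ev) = T.conf C ev k := by
  induction k with
  | zero => rfl
  | succ k ih => simp [List.range_succ, ih, conf_succ]

variable {T}

theorem IsRun.valid {C : Conf} {ev : ℕ → Ev} (h : T.IsRun C ev) (k : ℕ) :
    T.Valid C ((List.range k).map ev) := by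
  induction k with
  | zero => simp
  | succ k ih => simpa [List.range_succ, ih, exec_map_range] using h k

theorem IsRun.persist {C : Conf} {ev : ℕ → Ev} (h : T.IsRun C ev) {e : Ev} {i : ℕ}
    (he : T.Enabled (T.conf C ev i) e) {k : ℕ} (hik : i ≤ k) :
    (∃ j, i ≤ j ∧ j < k ∧ ev j = e) ∨ T.Enabled (T.conf C ev k) e := by
  induction k, hik using Nat.le_induction with
  | base => exact .inr he
  | succ k hik ih =>
    rcases ih with ⟨j, h1, h2, h3⟩ | h'
    · exact .inl ⟨j, h1, by omega, h3⟩
    · by_cases hek : e = ev k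
      · exact .inl ⟨k, hik, by omega, hek.symm⟩
      · exact .inr (T.persist h' (h k) hek)

/-- The infinite schedule that starts with `e` and continues with `ev`. -/
def consRun (e : Ev) (ev : ℕ → Ev) : ℕ → Ev
  | 0 => e
  | k + 1 => ev k

theorem conf_consRun (C : Conf) (e : Ev) (ev : ℕ → Ev) (k : ℕ) :
    T.conf C (consRun e ev) (k + 1) = T.conf (T.apply C e) ev k := by
  induction k with
  | zero => rfl
  | succ k ih => rw [conf_succ, ih]; rfl

theorem IsRun.cons {C : Conf} {e : Ev} (he : T.Enabled C e) {ev : ℕ → Ev}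
    (h : T.IsRun (T.apply C e) ev) : T.IsRun C (consRun e ev) := by
  intro k
  cases k with
  | zero => exact he
  | succ k => rw [conf_consRun]; exact h k

theorem Fair.cons {C : Conf} {e : Ev} (he : T.Enabled C e) {ev : ℕ → Ev} {Q : Set P}
    (h : T.Fair (T.apply C e) ev Q) : T.Fair C (consRun e ev) Q := by
  have key : ∀ k x, T.proc x ∈ Q → T.Enabled (T.conf C (consRun e ev) (k + 1)) x →
      ∃ k', k + 1 ≤ k' ∧ consRun e ev k' = x := by
    intro k x hx hk
    rw [conf_consRun] at hk
    obtain ⟨k', h1, h2⟩ := h.occurs k x hx hk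
    exact ⟨k' + 1, by omega, h2⟩
  refine ⟨?_, ?_⟩
  · intro k x hx hk
    cases k with
    | zero =>
      by_cases hxe : x = e
      · exact ⟨0, le_rfl, hxe.symm⟩
      · obtain ⟨k', -, h2⟩ := key 0 x hx (T.persist hk he hxe)
        exact ⟨k', by omega, h2⟩
    | succ k => exact key k x hx hk
  · obtain ⟨N, hN⟩ := h.eventually_mem
    refine ⟨N + 1, fun k hk => ?_⟩
    obtain ⟨k, rfl⟩ : ∃ m, k = m + 1 := ⟨k - 1, by omega⟩
    exact hN k (by omega)

/-- Events of any process may be prepended: an event enabled during `σ` either occurs there or stays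
enabled until the fair tail serves it. -/
theorem exists_prepend {C : Conf} {σ : List Ev} (hσ : T.Valid C σ) {ev : ℕ → Ev} {Q : Set P}
    (hr : T.IsRun (T.exec C σ) ev) (hf : T.Fair (T.exec C σ) ev Q) :
    ∃ ev', T.IsRun C ev' ∧ T.Fair C ev' Q ∧
      ∀ k, T.conf C ev' (σ.length + k) = T.conf (T.exec C σ) ev k := by
  induction σ generalizing C with
  | nil => exact ⟨ev, hr, hf, fun k => by simp⟩
  | cons e σ ih =>
    obtain ⟨ev', h1, h2, h3⟩ := ih hσ.2 hr hf
    refine ⟨consRun e ev', h1.cons hσ.1, h2.cons hσ.1, fun k => ?_⟩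
    rw [List.length_cons, show σ.length + 1 + k = (σ.length + k) + 1 by omega, conf_consRun, h3]
    rfl

theorem exists_limit {L : ℕ → List Ev} (hp : ∀ k, L k <+: L (k + 1))
    (hl : ∀ k, (L k).length < (L (k + 1)).length) :
    ∃ ev : ℕ → Ev, ∀ k i, i ≤ (L k).length → (L k).take i = (List.range i).map ev := by
  have hk : ∀ k, k ≤ (L k).length := fun k => by
    induction k with
    | zero => omega
    | succ k ih => have := hl k; omega
  have hmono : ∀ j k, j ≤ k → L j <+: L k := fun j k hjk => by
    induction k, hjk using Nat.le_induction with
    | base => exact List.prefix_rfl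
    | succ k _ ih => exact ih.trans (hp k)
  -- Lengths increase strictly, so position `m` exists in `L (m + 1)` and is never changed later.
  refine ⟨fun m => (L (m + 1))[m]'(hk (m + 1)), fun k i hi => ?_⟩
  refine List.ext_getElem (by simpa using hi) fun m h1 h2 => ?_
  simp only [List.length_take, List.length_map, List.length_range] at h1 h2
  simp only [List.getElem_take, List.getElem_map, List.getElem_range]
  rcases le_total k (m + 1) with h | h
  · exact (hmono _ _ h).getElem (by omega)
  · exact ((hmono _ _ h).getElem (hk (m + 1))).symm

/-- If an invariant can be restored after any given enabled event of a process in `Q`, then some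
run that is fair to the processes in `Q` satisfies the invariant infinitely often. -/
theorem exists_fair_run {I : Conf → Prop} {Q : Set P} (hQ : Q.Nonempty) {C₀ : Conf} (h₀ : I C₀)
    (hI : ∀ C, I C → ∀ e, T.proc e ∈ Q → T.Enabled C e →
      ∃ σ, T.Valid C σ ∧ (∀ x ∈ σ, T.proc x ∈ Q) ∧ e ∈ σ ∧ I (T.exec C σ)) :
    ∃ ev, T.IsRun C₀ ev ∧ T.Fair C₀ ev Q ∧ (∀ k, T.proc (ev k) ∈ Q) ∧
      ∀ k, ∃ k', k ≤ k' ∧ I (T.conf C₀ ev k') := by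
  obtain ⟨q, hq⟩ := hQ
  have henum : ∀ C, ∃ g : ℕ → Ev, ∀ e, T.Enabled C e → ∃ j, g j = e := by
    intro C
    obtain ⟨x, -, hx⟩ := T.exists_enabled C q
    obtain ⟨g, hg⟩ := (T.countable C).exists_eq_range ⟨x, hx⟩
    exact ⟨g, fun e he => by
      have : e ∈ Set.range g := hg ▸ he
      exact this⟩
  choose enum henum using henum
  let Good : List Ev → Prop := fun L =>
    T.Valid C₀ L ∧ (∀ x ∈ L, T.proc x ∈ Q) ∧ I (T.exec C₀ L)
  -- Dovetailing: stage `k`, read as a pair `(i, j)`, serves the `j`-th event enabled after the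
  -- first `i` events, if it belongs to `Q` and is still enabled. Otherwise any event of `q` is
  -- served, so that the schedule grows.
  have hstage : ∀ (k : ℕ) (L : {L // Good L}), ∃ L' : {L // Good L}, ∃ σ, L'.1 = L.1 ++ σ ∧
      0 < σ.length ∧ ∀ e, enum (T.exec C₀ (L.1.take k.unpair.1)) k.unpair.2 = e →
        T.proc e ∈ Q → T.Enabled (T.exec C₀ L.1) e → e ∈ σ := by
    rintro k ⟨L, hL⟩
    have ext : ∀ e, T.proc e ∈ Q → T.Enabled (T.exec C₀ L) e →
        ∃ L' : {L // Good L}, ∃ σ, L'.1 = L ++ σ ∧ 0 < σ.length ∧ e ∈ σ := by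
      intro e he he'
      obtain ⟨σ, h1, h2, h3, h4⟩ := hI _ hL.2.2 e he he'
      refine ⟨⟨L ++ σ, by simp [hL.1, h1], ?_, by simpa using h4⟩, σ, rfl,
        List.length_pos_of_mem h3, h3⟩
      intro x hx
      rcases List.mem_append.1 hx with hx | hx
      exacts [hL.2.1 x hx, h2 x hx]
    by_cases h : T.proc (enum (T.exec C₀ (L.take k.unpair.1)) k.unpair.2) ∈ Q ∧
        T.Enabled (T.exec C₀ L) (enum (T.exec C₀ (L.take k.unpair.1)) k.unpair.2)
    · obtain ⟨L', σ, h1, h2, h3⟩ := ext _ h.1 h.2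
      exact ⟨L', σ, h1, h2, fun e he _ _ => he ▸ h3⟩
    · obtain ⟨x, hx, hx'⟩ := T.exists_enabled (T.exec C₀ L) q
      obtain ⟨L', σ, h1, h2, -⟩ := ext x (hx ▸ hq) hx'
      exact ⟨L', σ, h1, h2, fun e he ha hb => (h (by rw [he]; exact ⟨ha, hb⟩)).elim⟩
  choose next tail hnext htail hmem using hstage
  let L : ℕ → {L // Good L} := fun k => Nat.rec ⟨[], trivial, by simp, h₀⟩ next k
  have hL : ∀ k, (L (k + 1)).1 = (L k).1 ++ tail k (L k) := fun k => hnext k (L k)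
  have hlen : ∀ k, (L k).1.length < (L (k + 1)).1.length := fun k => by
    rw [hL]; simpa using htail k (L k)
  obtain ⟨ev, hev⟩ := exists_limit (L := fun k => (L k).1)
    (fun k => hL k ▸ List.prefix_append _ _) hlen
  have hk : ∀ k, k ≤ (L k).1.length := fun k => by
    induction k with
    | zero => omega
    | succ k ih => have := hlen k; omega
  have hfull : ∀ k, (L k).1 = (List.range (L k).1.length).map ev := fun k => by
    simpa using hev k _ le_rfl
  have hexec : ∀ k, T.exec C₀ (L k).1 = T.conf C₀ ev (L k).1.length := fun k => by
    conv_lhs => rw [hfull k]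
    rw [exec_map_range]
  have hvalid : ∀ k, T.Valid C₀ ((List.range k).map ev) := fun k => by
    have h := (L k).2.1
    rw [← List.take_append_drop k (L k).1, valid_append, hev k k (hk k)] at h
    exact h.1
  have hrun : T.IsRun C₀ ev := fun k => by
    have h := hvalid (k + 1)
    rw [List.range_succ, List.map_append, valid_append, exec_map_range] at h
    exact h.2.1
  have hproc : ∀ k, T.proc (ev k) ∈ Q := fun k => by
    refine (L (k + 1)).2.2.1 _ ?_
    rw [hfull (k + 1)]
    exact List.mem_map_of_mem (List.mem_range.2 (hk (k + 1)))
  refine ⟨ev, hrun, ⟨fun i e he hen => ?_, 0, fun k _ => hproc k⟩, hproc,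
    fun k => ⟨_, hk k, hexec k ▸ (L k).2.2.2⟩⟩
  obtain ⟨j, hj⟩ := henum _ e hen
  -- The first `i` events are already fixed at stage `Nat.pair i j`, so that stage serves the
  -- intended event unless it has occurred before.
  have hik : i ≤ (L (Nat.pair i j)).1.length := (Nat.left_le_pair i j).trans (hk _)
  rcases hrun.persist hen hik with ⟨m, h1, -, h3⟩ | h
  · exact ⟨m, h1, h3⟩
  · have hm := hmem (Nat.pair i j) (L (Nat.pair i j)) e
      (by rw [Nat.unpair_pair, hev _ i hik, exec_map_range]; exact hj) he (hexec _ ▸ h)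
    obtain ⟨m, hm, hme⟩ := List.mem_iff_getElem.1 hm
    refine ⟨(L (Nat.pair i j)).1.length + m, by omega, ?_⟩
    have h1 : (L (Nat.pair i j + 1)).1[(L (Nat.pair i j)).1.length + m]? = some e := by
      rw [hL, List.getElem?_append_right (by omega)]
      simp [hm, hme]
    rw [hfull (Nat.pair i j + 1), List.getElem?_map] at h1
    obtain ⟨a, ha, ha'⟩ := Option.map_eq_some_iff.1 h1
    obtain ⟨h2, rfl⟩ := List.getElem?_eq_some_iff.1 ha
    simpa using ha'

/-- Runs fair to all processes in `Q` in which no other process takes a step exist. -/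
theorem exists_silent_run {Q : Set P} (hQ : Q.Nonempty) (C₀ : Conf) :
    ∃ ev, T.IsRun C₀ ev ∧ T.Fair C₀ ev Q ∧ ∀ k, T.proc (ev k) ∈ Q := by
  obtain ⟨ev, h1, h2, h3, -⟩ := exists_fair_run (T := T) (I := fun _ => True) hQ (C₀ := C₀) trivial
    fun C _ e he hen => ⟨[e], by simpa using hen, by simpa using he, by simp, trivial⟩
  exact ⟨ev, h1, h2, h3⟩

variable (T) in
/-- Some schedule leads to a configuration with decision `b`. -/
def CanDecide (dec : Conf → Bool → Prop) (C : Conf) (b : Bool) : Prop :=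
  ∃ σ, T.Valid C σ ∧ dec (T.exec C σ) b

theorem CanDecide.of_exec {dec : Conf → Bool → Prop} {C : Conf} {σ : List Ev} (hσ : T.Valid C σ)
    {b : Bool} (h : T.CanDecide dec (T.exec C σ) b) : T.CanDecide dec C b := by
  obtain ⟨τ, h1, h2⟩ := h
  exact ⟨σ ++ τ, by simp [hσ, h1], by simpa using h2⟩

/-! ### The bivalence argument -/

section FLP

variable {dec : Conf → Bool → Prop} {C₀ : Conf}

/-- From every reachable configuration, a decision can be reached without steps of a given
process. -/
theorem exists_silent_decision [Nontrivial P]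
    (mono : ∀ {C e b}, T.Enabled C e → dec C b → dec (T.apply C e) b)
    (decides : ∀ ev Q, Qᶜ.Subsingleton → T.IsRun C₀ ev → T.Fair C₀ ev Q →
      ∃ k b, dec (T.conf C₀ ev k) b)
    {σ : List Ev} (hσ : T.Valid C₀ σ) (p : P) :
    ∃ τ b, T.Valid (T.exec C₀ σ) τ ∧ (∀ x ∈ τ, T.proc x ≠ p) ∧
      dec (T.exec (T.exec C₀ σ) τ) b := by
  obtain ⟨q, hq⟩ := exists_ne p
  obtain ⟨ev, hr, hf, hp⟩ := exists_silent_run (T := T) (Q := {p}ᶜ) ⟨q, hq⟩ (T.exec C₀ σ)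
  obtain ⟨ev', hr', hf', hc⟩ := exists_prepend hσ hr hf
  obtain ⟨k, b, hk⟩ := decides ev' {p}ᶜ (by simp) hr' hf'
  -- The decision may already fall inside `σ`; it persists until `k` steps after the end of `σ`.
  have hmono : ∀ j, dec (T.conf C₀ ev' (k + j)) b := fun j => by
    induction j with
    | zero => exact hk
    | succ j ih => exact mono (hr' _) ih
  refine ⟨(List.range k).map ev, b, hr.valid k, ?_, ?_⟩
  · intro x hx
    obtain ⟨m, -, rfl⟩ := List.mem_map.1 hx
    exact hp m
  · rw [exec_map_range, ← hc, add_comm]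
    exact hmono _

/-- From a bivalent configuration, every enabled event can be made to occur in such a way that the
resulting configuration is bivalent again. -/
theorem exists_bivalent_extension
    (mono : ∀ {C e b}, T.Enabled C e → dec C b → dec (T.apply C e) b)
    (silent : ∀ σ, T.Valid C₀ σ → ∀ p, ∃ τ b, T.Valid (T.exec C₀ σ) τ ∧
      (∀ x ∈ τ, T.proc x ≠ p) ∧ dec (T.exec (T.exec C₀ σ) τ) b)
    {e : Ev} {b : Bool} (ρ : List Ev) (σ : List Ev) (hσ : T.Valid C₀ σ)
    (he : T.Enabled (T.exec C₀ σ) e) (hρ : T.Valid (T.exec C₀ σ) ρ)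
    (hb : dec (T.exec (T.exec C₀ σ) ρ) b)
    (hb' : ¬ T.CanDecide dec (T.apply (T.exec C₀ σ) e) b) :
    ∃ τ, T.Valid (T.exec C₀ σ) τ ∧ e ∈ τ ∧
      ∀ b, T.CanDecide dec (T.exec (T.exec C₀ σ) τ) b := by
  -- Move along `ρ` towards decision `b`, looking for the first step `x` after which performing `e`
  -- makes `b` attainable; before `x` it does not. Such a step exists because `b` is decided at the
  -- end of `ρ`.
  induction ρ generalizing σ with
  | nil => exact (hb' ⟨[], trivial, mono he hb⟩).elim
  | cons x ρ ih =>
    set C := T.exec C₀ σ with hC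
    by_cases hx : e = x
    · subst hx
      exact (hb' ⟨ρ, hρ.2, hb⟩).elim
    have hσx : T.Valid C₀ (σ ++ [x]) := by simpa [hσ] using hρ.1
    have hex : T.exec C₀ (σ ++ [x]) = T.apply C x := by simp [hC]
    have hen : T.Enabled (T.apply C x) e := T.persist he hρ.1 hx
    by_cases hd : T.CanDecide dec (T.apply (T.apply C x) e) b
    swap
    · obtain ⟨τ, h1, h2, h3⟩ := ih (σ ++ [x]) hσx (hex ▸ hen) (hex ▸ hρ.2) (hex ▸ hb) (hex ▸ hd)
      rw [hex] at h1 h3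
      exact ⟨x :: τ, ⟨hρ.1, h1⟩, by simp [h2], h3⟩
    by_cases hp : T.proc e = T.proc x
    swap
    · have h := T.comm hp he hρ.1
      rw [← h] at hd
      exact (hb' (CanDecide.of_exec (σ := [x]) (by simpa using T.persist hρ.1 he (Ne.symm hx))
        hd)).elim
    -- Now one process takes both `e` and `x`. A deciding schedule `τ` without that process commutes
    -- with both: after `e` it rules out `b' = b`, and after `x, e` it makes `b'` attainable beside
    -- `b`.
    obtain ⟨τ, b', h1, h2, h3⟩ := silent σ hσ (T.proc e)
    obtain ⟨h4, h5, h6⟩ := Valid.comm he h1 h2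
    have hbb : b' ≠ b := by
      rintro rfl
      exact hb' ⟨τ, h4, h6 ▸ mono h5 h3⟩
    refine ⟨[x, e], ⟨hρ.1, hen, trivial⟩, by simp, fun c => ?_⟩
    by_cases hc : c = b
    · exact hc ▸ hd
    obtain rfl : c = b' := by
      revert hc hbb; cases b <;> cases b' <;> cases c <;> simp
    obtain ⟨h7, h8, h9⟩ := Valid.comm hρ.1 h1 (hp ▸ h2)
    obtain ⟨h10, h11, h12⟩ := Valid.comm hen h7 h2
    refine ⟨τ, h10, ?_⟩
    change dec (T.exec (T.apply (T.apply C x) e) τ) c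
    rw [h12]
    exact mono h11 (h9 ▸ mono h8 h3)

/-- The theorem of Fischer, Lynch and Paterson: agreement, the possibility of both decisions, and
decision in all runs in which at most one process crashes are incompatible. -/
theorem fischer_lynch_paterson [Nontrivial P]
    (mono : ∀ {C e b}, T.Enabled C e → dec C b → dec (T.apply C e) b)
    (agree : ∀ σ, T.Valid C₀ σ → ¬ (dec (T.exec C₀ σ) true ∧ dec (T.exec C₀ σ) false))
    (decides : ∀ ev Q, Qᶜ.Subsingleton → T.IsRun C₀ ev → T.Fair C₀ ev Q →
      ∃ k b, dec (T.conf C₀ ev k) b)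
    (bivalent : ∀ b, T.CanDecide dec C₀ b) : False := by
  have silent : ∀ σ, T.Valid C₀ σ → ∀ p, ∃ τ b, T.Valid (T.exec C₀ σ) τ ∧
      (∀ x ∈ τ, T.proc x ≠ p) ∧ dec (T.exec (T.exec C₀ σ) τ) b :=
    fun σ hσ p => exists_silent_decision (dec := dec) mono decides hσ p
  have monoσ : ∀ (σ : List Ev) C b, T.Valid C σ → dec C b → dec (T.exec C σ) b := by
    intro σ
    induction σ with
    | nil => exact fun _ _ _ h => h
    | cons e σ ih => exact fun C b h h' => ih _ _ h.2 (mono h.1 h')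
  -- A crash-free fair run that is bivalent infinitely often. It must decide, and at a later
  -- bivalent configuration the opposite decision can be added, against agreement.
  obtain ⟨ev, hr, hf, -, hI⟩ := exists_fair_run (T := T) (Q := Set.univ) Set.univ_nonempty
    (I := fun C => (∃ σ, T.Valid C₀ σ ∧ T.exec C₀ σ = C) ∧ ∀ b, T.CanDecide dec C b) (C₀ := C₀)
    ⟨⟨[], trivial, rfl⟩, bivalent⟩ (by
      rintro C ⟨⟨σ, hσ, rfl⟩, hC⟩ e - he
      have : ∃ τ, T.Valid (T.exec C₀ σ) τ ∧ e ∈ τ ∧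
          ∀ b, T.CanDecide dec (T.exec (T.exec C₀ σ) τ) b := by
        by_cases h : ∀ b, T.CanDecide dec (T.apply (T.exec C₀ σ) e) b
        · exact ⟨[e], ⟨he, trivial⟩, by simp, h⟩
        · push Not at h
          obtain ⟨b, hb⟩ := h
          obtain ⟨ρ, hρ, hρb⟩ := hC b
          exact exists_bivalent_extension (dec := dec) mono silent ρ σ hσ he hρ hρb hb
      obtain ⟨τ, h1, h2, h3⟩ := this
      exact ⟨τ, h1, by simp, h2, ⟨σ ++ τ, by simp [hσ, h1], by simp⟩, h3⟩)
  obtain ⟨k, b, hk⟩ := decides ev Set.univ (by simp) hr hf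
  obtain ⟨k', hkk', -, hb⟩ := hI k
  have hk' : dec (T.conf C₀ ev k') b := by
    clear hb
    induction k', hkk' using Nat.le_induction with
    | base => exact hk
    | succ m _ ih => exact mono (hr m) ih
  have hv := hr.valid k'
  obtain ⟨τ, h1, h2⟩ := hb (!b)
  have h3 := monoσ τ _ b h1 hk'
  refine agree ((List.range k').map ev ++ τ) ?_ ?_
  · simp [hv, exec_map_range, h1]
  · simp only [exec_append, exec_map_range]
    cases b
    · exact ⟨h2, h3⟩
    · exact ⟨h3, h2⟩

end FLP

end EventSystem

variable {n : ℕ} {A : Algorithm.{u, v} n}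

/-! ### Steps of distinct processes commute -/

namespace Config

variable {c : Config A} {p q : Proc n} {x y : Input n A.Msg}

theorem step_state_self : (c.step p x).state p = A.next p (c.state p) x := by
  simp [step]

theorem step_state_of_ne (h : q ≠ p) : (c.step p x).state q = c.state q := by
  simp [step, h]

theorem step_buffer_self : (c.step p x).buffer p =
    c.remaining p x + (A.send p (c.state p) x p).map (fun m => (p, m)) := by
  simp [step]

theorem step_buffer_of_ne (h : q ≠ p) : (c.step p x).buffer q =
    c.buffer q + (A.send p (c.state p) x q).map (fun m => (p, m)) := by
  simp [step, h]

theorem remaining_step_of_ne (h : q ≠ p) (hy : c.Enabled q y) :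
    (c.step p x).remaining q y =
      c.remaining q y + (A.send p (c.state p) x q).map (fun m => (p, m)) := by
  classical
  cases y with
  | receive r m =>
    simp only [remaining, step_buffer_of_ne h]
    convert Multiset.erase_add_left_pos _ hy
  | _ => simp only [remaining, step_buffer_of_ne h]

theorem Enabled.step_of_ne (hx : c.Enabled p x) (h : p ≠ q) : (c.step q y).Enabled p x := by
  cases x with
  | receive r m =>
    change _ ∈ (c.step q y).buffer p
    rw [step_buffer_of_ne h]
    exact Multiset.mem_add.2 (.inl hx)
  | _ => trivial

theorem Enabled.step_self (hx : c.Enabled p x) (h : x ≠ y) : (c.step p y).Enabled p x := by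
  classical
  cases x with
  | receive r m =>
    change _ ∈ (c.step p y).buffer p
    rw [step_buffer_self]
    refine Multiset.mem_add.2 (.inl ?_)
    cases y with
    | receive r' m' =>
      have hne : (r, m) ≠ (r', m') := by
        rintro ⟨⟩
        exact h rfl
      simp only [remaining]
      convert (Multiset.mem_erase_of_ne hne).2 hx
    | _ => exact hx
  | _ => trivial

/-- A step reads and changes only its own process's state, removes messages only from its own
buffer, and only adds to the other buffers. As buffers are multisets, the order of additions is
immaterial. -/
theorem step_comm (hpq : p ≠ q) (hx : c.Enabled p x) (hy : c.Enabled q y) :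
    (c.step p x).step q y = (c.step q y).step p x := by
  have ext : ∀ {d d' : Config A}, (∀ r, d.state r = d'.state r) →
      (∀ r, d.buffer r = d'.buffer r) → d = d' := by
    rintro ⟨s, b⟩ ⟨s', b'⟩ h h'
    obtain rfl : s = s' := funext h
    obtain rfl : b = b' := funext h'
    rfl
  refine ext (fun r => ?_) (fun r => ?_)
  · by_cases hrp : r = p
    · subst hrp
      rw [step_state_of_ne hpq, step_state_self, step_state_self, step_state_of_ne hpq]
    · by_cases hrq : r = q
      · subst hrq
        rw [step_state_self, step_state_of_ne hrp, step_state_of_ne hrp, step_state_self]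
      · rw [step_state_of_ne hrq, step_state_of_ne hrp, step_state_of_ne hrp, step_state_of_ne hrq]
  · by_cases hrp : r = p
    · subst hrp
      rw [step_buffer_of_ne hpq, step_buffer_self, step_buffer_self, remaining_step_of_ne hpq hx,
        step_state_of_ne hpq, step_state_of_ne hpq.symm, add_right_comm]
    · by_cases hrq : r = q
      · subst hrq
        rw [step_buffer_self, step_buffer_of_ne hrp, step_buffer_self,
          remaining_step_of_ne hrp hy, step_state_of_ne hpq, step_state_of_ne hpq.symm,
          add_right_comm]
      · rw [step_buffer_of_ne hrq, step_buffer_of_ne hrp, step_buffer_of_ne hrp,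
          step_buffer_of_ne hrq, step_state_of_ne hpq, step_state_of_ne hpq.symm, add_right_comm]

end Config

/-! ### One-shot systems -/

/-- Whether an input is an invocation. -/
def Input.isInvoke {M : Type v} : Input n M → Bool
  | .invoke _ => true
  | _ => false

/-- A configuration, together with a record for each server of whether it has invoked an operation
and of the first response since then. -/
structure Tracked (A : Algorithm.{u, v} n) where
  config : Config A
  record : Fin n → Bool × Option (Response n)

/-- The record of a server after a step with input `x` in which `r` is returned. -/
def updateRecord {M : Type v} (m : Bool × Option (Response n)) (x : Input n M)
    (r : Option (Response n)) : Bool × Option (Response n) :=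
  -- The invoking step may itself return the response; `Option.or` keeps the earliest one.
  if m.1 || x.isInvoke then (true, m.2.or r) else m

namespace Tracked

variable (A) in
/-- The initial configuration, with empty records. -/
def initial : Tracked A := ⟨Config.initial A, fun _ => (false, none)⟩

/-- The configuration after a step of server `e.1` with input `e.2`. -/
noncomputable def apply (c : Tracked A) (e : Fin n × Input n A.Msg) : Tracked A where
  config := c.config.step (.inl e.1) e.2
  record := Function.update c.record e.1 (updateRecord (c.record e.1) e.2
    (A.respond (.inl e.1) (c.config.state (.inl e.1)) e.2))

/-- The step `e` is possible, where a server in `U` may invoke the operation `o` once, and there are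
no other invocations. -/
def Enabled (U : Set (Fin n)) (o : Op n) (c : Tracked A) (e : Fin n × Input n A.Msg) : Prop :=
  c.config.Enabled (.inl e.1) e.2 ∧
    ∀ o', e.2 = .invoke o' → o' = o ∧ e.1 ∈ U ∧ (c.record e.1).1 = false

theorem apply_record_of_ne {c : Tracked A} {e : Fin n × Input n A.Msg} {p : Fin n} (h : p ≠ e.1) :
    (c.apply e).record p = c.record p := by
  simp [apply, h]

end Tracked

open Tracked in
/-- The event system in which only servers take steps, and each server in `U` may invoke the
operation `o` once. -/
noncomputable def oneShot (A : Algorithm.{u, v} n) (U : Set (Fin n)) (o : Op n) :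
    EventSystem (Fin n) (Fin n × Input n A.Msg) (Tracked A) where
  proc := Prod.fst
  Enabled := Enabled U o
  apply := Tracked.apply
  persist := by
    rintro c ⟨p, x⟩ ⟨q, y⟩ ⟨hx, hxo⟩ ⟨hy, hyo⟩ hne
    by_cases hpq : p = q
    · subst hpq
      have hxy : x ≠ y := fun h => hne (by rw [h])
      refine ⟨hx.step_self hxy, ?_⟩
      rintro o' rfl
      obtain ⟨rfl, hU, hr⟩ := hxo _ rfl
      refine ⟨rfl, hU, ?_⟩
      -- The only permitted invocation is that of `o`, so a competing invocation `y` would equal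
      -- `x`.
      have : y.isInvoke = false := by
        cases y with
        | invoke o'' => exact (hxy (by rw [(hyo _ rfl).1])).elim
        | _ => rfl
      simp only at hr
      simp [Tracked.apply, updateRecord, hr, this]
    · refine ⟨hx.step_of_ne (by simpa using hpq), fun o' h => ?_⟩
      rw [apply_record_of_ne hpq]
      exact hxo o' h
  comm := by
    rintro c ⟨p, x⟩ ⟨q, y⟩ hpq ⟨hx, -⟩ ⟨hy, -⟩
    have hpq' : (Sum.inl p : Proc n) ≠ Sum.inl q := by simpa using hpq
    have hpq2 : p ≠ q := hpq
    simp only [Tracked.apply, Tracked.mk.injEq]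
    refine ⟨Config.step_comm hpq' hx hy, ?_⟩
    rw [Function.update_of_ne hpq2.symm, Function.update_of_ne hpq2,
      Config.step_state_of_ne hpq'.symm, Config.step_state_of_ne hpq',
      Function.update_comm hpq2]
  countable := by
    intro c
    -- Although `Op n` and the message type may be uncountable, only one operation can be invoked
    -- and only finitely many messages are in transit.
    refine Set.Countable.mono (s₂ := ⋃ p : Fin n, ({(p, .idle), (p, .invoke o)} ∪
      (fun z : Proc n × A.Msg => (p, .receive z.1 z.2)) '' {z | z ∈ c.config.buffer (.inl p)}))
      ?_ (Set.countable_iUnion fun p => ?_)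
    · rintro ⟨p, x⟩ ⟨hx, hxo⟩
      refine Set.mem_iUnion.2 ⟨p, ?_⟩
      cases x with
      | idle => simp
      | invoke o' => simp [(hxo o' rfl).1]
      | receive q m => exact .inr ⟨(q, m), hx, rfl⟩
    · exact ((Set.toFinite _).union ((Multiset.finite_toSet _).image _)).countable
  exists_enabled c p := ⟨(p, .idle), rfl, trivial, fun _ h => by cases h⟩

/-! ### From fair schedules to admissible executions -/

section Runs

variable {U : Set (Fin n)} {o : Op n} {ev : ℕ → Fin n × Input n A.Msg}

/-- The execution given by an infinite schedule. -/
noncomputable def runExecution (h : (oneShot A U o).IsRun (Tracked.initial A) ev) : Execution A where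
  actor k := .inl (ev k).1
  input k := (ev k).2
  config k := ((oneShot A U o).conf (Tracked.initial A) ev k).config
  config_zero := rfl
  enabled k := (h k).1
  config_succ _ := rfl

variable (h : (oneShot A U o).IsRun (Tracked.initial A) ev)

theorem runExecution_invokes_iff {k : ℕ} {p : Proc n} {o' : Op n} :
    (runExecution h).Invokes k p o' ↔ p = .inl (ev k).1 ∧ (ev k).2 = .invoke o' :=
  and_congr_left' eq_comm

theorem runExecution_invokes_eq {k : ℕ} {p : Proc n} {o' : Op n}
    (hk : (runExecution h).Invokes k p o') : o' = o ∧ ∃ i ∈ U, p = .inl i := by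
  rw [runExecution_invokes_iff] at hk
  obtain ⟨h1, h2, -⟩ := (h k).2 o' hk.2
  exact ⟨h1, _, h2, hk.1⟩

/-- What the record of a server says about the execution. -/
theorem record_spec (k : ℕ) (p : Fin n) :
    (((oneShot A U o).conf (Tracked.initial A) ev k).record p = (false, none) ∧
      ∀ i < k, ¬ (runExecution h).Invokes i (.inl p) o) ∨
    ∃ j < k, (runExecution h).Invokes j (.inl p) o ∧
      (∀ i < k, (runExecution h).Invokes i (.inl p) o → i = j) ∧
      ((((oneShot A U o).conf (Tracked.initial A) ev k).record p = (true, none) ∧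
        ∀ i, j ≤ i → i < k → (runExecution h).actor i = .inl p →
          (runExecution h).output i = none) ∨
      ∃ r, ((oneShot A U o).conf (Tracked.initial A) ev k).record p = (true, some r) ∧
        ∃ i < k, (runExecution h).RespondsAt j i r) := by
  induction k with
  | zero => exact .inl ⟨rfl, by simp⟩
  | succ k ih =>
    set E := runExecution h with hE
    set c := (oneShot A U o).conf (Tracked.initial A) ev k with hc
    have hsucc : (oneShot A U o).conf (Tracked.initial A) ev (k + 1) = c.apply (ev k) := rfl
    rw [hsucc]
    by_cases hp : p = (ev k).1
    swap
    · rw [Tracked.apply_record_of_ne hp]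
      have hact : E.actor k ≠ .inl p := by
        simpa [hE, runExecution] using Ne.symm hp
      rcases ih with ⟨h1, h2⟩ | ⟨j, hj, h1, h2, h3⟩
      · refine .inl ⟨h1, fun i hi hinv => ?_⟩
        rcases Nat.lt_succ_iff_lt_or_eq.1 hi with hi | rfl
        · exact h2 i hi hinv
        · exact hact hinv.1
      · refine .inr ⟨j, by omega, h1, fun i hi hinv => ?_, ?_⟩
        · rcases Nat.lt_succ_iff_lt_or_eq.1 hi with hi | rfl
          · exact h2 i hi hinv
          · exact (hact hinv.1).elim
        · rcases h3 with ⟨h3, h4⟩ | ⟨r, h3, i, hi, h4⟩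
          · refine .inl ⟨h3, fun i hji hi ha => ?_⟩
            rcases Nat.lt_succ_iff_lt_or_eq.1 hi with hi | rfl
            · exact h4 i hji hi ha
            · exact (hact ha).elim
          · exact .inr ⟨r, h3, i, by omega, h4⟩
    have hact : E.actor k = .inl p := by simp [hE, runExecution, hp]
    have hrec : (c.apply (ev k)).record p = updateRecord (c.record p) (ev k).2 (E.output k) := by
      subst hp
      simp [Tracked.apply, Execution.output, hE, runExecution, ← hc]
    have hnoinv : (c.record p).1 = true → (ev k).2.isInvoke = false := by
      intro hr
      cases hx : (ev k).2 with
      | invoke o' =>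
        have := ((h k).2 o' hx).2.2
        rw [← hp, hr] at this
        cases this
      | _ => rfl
    have hinv : E.Invokes k (.inl p) o ↔ (ev k).2.isInvoke = true := by
      rw [runExecution_invokes_iff]
      constructor
      · rintro ⟨-, hx⟩
        rw [hx]; rfl
      · intro hx
        refine ⟨by rw [hp], ?_⟩
        cases hx' : (ev k).2 with
        | invoke o' => rw [((h k).2 o' hx').1]
        | _ => rw [hx'] at hx; cases hx
    rw [hrec]
    rcases ih with ⟨h1, h2⟩ | ⟨j, hj, h1, h2, h3⟩
    · cases hx : (ev k).2.isInvoke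
      · refine .inl ⟨by simp [updateRecord, h1, hx], fun i hi hi' => ?_⟩
        rcases Nat.lt_succ_iff_lt_or_eq.1 hi with hi | rfl
        · exact h2 i hi hi'
        · rw [hinv, hx] at hi'; cases hi'
      · refine .inr ⟨k, by omega, hinv.2 hx, fun i hi hi' => ?_, ?_⟩
        · rcases Nat.lt_succ_iff_lt_or_eq.1 hi with hi | rfl
          · exact (h2 i hi hi').elim
          · rfl
        -- A response in the invoking step itself counts as the response to that invocation.
        · cases ho : E.output k with
          | none =>
            refine .inl ⟨by simp [updateRecord, h1, hx], fun i hi hi' _ => ?_⟩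
            obtain rfl : i = k := by omega
            exact ho
          | some r =>
            refine .inr ⟨r, by simp [updateRecord, h1, hx], k, by omega, le_rfl, rfl, ho, ?_⟩
            intro i hi hi'
            omega
    · have hr1 : (c.record p).1 = true := by
        rcases h3 with ⟨h3, -⟩ | ⟨r, h3, -⟩ <;> rw [h3]
      have hx := hnoinv hr1
      refine .inr ⟨j, by omega, h1, fun i hi hi' => ?_, ?_⟩
      · rcases Nat.lt_succ_iff_lt_or_eq.1 hi with hi | rfl
        · exact h2 i hi hi'
        · rw [hinv, hx] at hi'; cases hi'
      · rcases h3 with ⟨h3, h4⟩ | ⟨r, h3, i, hi, h4⟩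
        · cases ho : E.output k with
          | none =>
            refine .inl ⟨by simp [updateRecord, h3], fun i hji hi ha => ?_⟩
            rcases Nat.lt_succ_iff_lt_or_eq.1 hi with hi | rfl
            · exact h4 i hji hi ha
            · exact ho
          | some r =>
            refine .inr ⟨r, by simp [updateRecord, h3], k, by omega, by omega,
              hact.trans h1.1.symm, ho, fun i hji hi ha => h4 i hji hi (ha.trans h1.1)⟩
        · exact .inr ⟨r, by simp [updateRecord, h3], i, by omega, h4⟩

theorem runExecution_invokes_unique {i j : ℕ} {p : Fin n}
    (hi : (runExecution h).Invokes i (.inl p) o) (hj : (runExecution h).Invokes j (.inl p) o) :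
    i = j := by
  rcases record_spec h (i + j + 1) p with ⟨-, h1⟩ | ⟨l, -, -, h1, -⟩
  · exact (h1 i (by omega) hi).elim
  · rw [h1 i (by omega) hi, h1 j (by omega) hj]

theorem Execution.RespondsAt.unique {E : Execution A} {j k k' : ℕ} {r r' : Response n}
    (h1 : E.RespondsAt j k r) (h2 : E.RespondsAt j k' r') : k = k' ∧ r = r' := by
  obtain ⟨a1, a2, a3, a4⟩ := h1
  obtain ⟨b1, b2, b3, b4⟩ := h2
  have hk : k = k' := by
    rcases lt_trichotomy k k' with hlt | he | hlt
    · rw [b4 k a1 hlt a2] at a3; cases a3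
    · exact he
    · rw [a4 k' b1 hlt b2] at b3; cases b3
  subst hk
  exact ⟨rfl, Option.some.inj (a3.symm.trans b3)⟩

theorem exists_respondsAt_of_record {k : ℕ} {p : Fin n} {r : Response n}
    (hr : (((oneShot A U o).conf (Tracked.initial A) ev k).record p).2 = some r) :
    ∃ j, (runExecution h).Invokes j (.inl p) o ∧ ∃ i, (runExecution h).RespondsAt j i r := by
  rcases record_spec h k p with ⟨h1, -⟩ | ⟨j, -, h1, -, ⟨h2, -⟩ | ⟨r', h2, i, -, h3⟩⟩
  · rw [h1] at hr; cases hr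
  · rw [h2] at hr; cases hr
  · rw [h2] at hr
    obtain rfl : r' = r := Option.some.inj hr
    exact ⟨j, h1, i, h3⟩

theorem record_of_respondsAt {j i : ℕ} {p : Fin n} {r : Response n}
    (hj : (runExecution h).Invokes j (.inl p) o) (hr : (runExecution h).RespondsAt j i r) :
    (((oneShot A U o).conf (Tracked.initial A) ev (i + 1)).record p).2 = some r := by
  rcases record_spec h (i + 1) p with ⟨-, h1⟩ | ⟨j', -, h1, -, ⟨-, h3⟩ | ⟨r', h2, i', -, h3⟩⟩
  · exact (h1 j (Nat.lt_succ_of_le hr.1) hj).elim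
  · obtain rfl := runExecution_invokes_unique h hj h1
    have := h3 i hr.1 (by omega) (hr.2.1.trans hj.1)
    rw [hr.2.2.1] at this
    cases this
  · obtain rfl := runExecution_invokes_unique h hj h1
    rw [h2, (hr.unique h3).2]

/-- Sequentiality is vacuous: no server invokes twice. -/
theorem runExecution_wellFormed {s : Fin n} {Δ : ℝ} (hΔ : Δ ≠ 0)
    (h : (oneShot A U (.reassign s Δ)).IsRun (Tracked.initial A) ev) :
    (runExecution h).WellFormed where
  sequential j k p o₁ o₂ hjk h1 h2 := by
    obtain ⟨rfl, i, -, rfl⟩ := runExecution_invokes_eq h h1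
    obtain ⟨rfl, -⟩ := runExecution_invokes_eq h h2
    exact (hjk.ne (runExecution_invokes_unique h h1 h2)).elim
  servers_only k p _ _ h1 := by
    obtain ⟨-, i, -, hi⟩ := runExecution_invokes_eq h h1
    exact ⟨i, hi⟩
  ne_zero k p _ Δ' h1 := by
    obtain ⟨h2, -⟩ := runExecution_invokes_eq h h1
    cases h2
    exact hΔ

variable {Q : Set (Fin n)}

/-- Idle events are always enabled, so fairness gives each process in `Q` infinitely many steps; all
others eventually stop, and clients never act. -/
theorem runExecution_correct_iff
    (hf : (oneShot A U o).Fair (Tracked.initial A) ev Q) {p : Proc n} :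
    (runExecution h).Correct p ↔ ∃ q ∈ Q, p = .inl q := by
  constructor
  · intro hp
    obtain ⟨N, hN⟩ := hf.eventually_mem
    obtain ⟨k, hk, rfl⟩ := hp N
    exact ⟨_, hN k hk, rfl⟩
  · rintro ⟨q, hq, rfl⟩ k
    obtain ⟨k', h1, h2⟩ := hf.occurs k (q, .idle) hq ⟨trivial, fun _ h => by cases h⟩
    exact ⟨k', h1, by simp [runExecution, h2]⟩

/-- Fairness to receive events is reliability of the links, and the at most one server outside `Q`
fits the bound since `f ≥ 1`. -/
theorem runExecution_admissible
    (hf : (oneShot A U o).Fair (Tracked.initial A) ev Q) {f : ℕ} (hf0 : 0 < f) (hQ : Qᶜ.Subsingleton) :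
    (runExecution h).Admissible f where
  crashes := by
    refine le_trans ?_ (Nat.succ_le_of_lt hf0)
    refine Set.ncard_le_one_iff_subsingleton.2 (hQ.anti fun s hs => ?_)
    intro hs'
    exact hs ((runExecution_correct_iff h hf).2 ⟨s, hs', rfl⟩)
  reliable p hp k q m hm := by
    obtain ⟨i, hi, rfl⟩ := (runExecution_correct_iff h hf).1 hp
    obtain ⟨k', h1, h2⟩ := hf.occurs k (i, .receive q m) hi ⟨hm, fun _ h => by cases h⟩
    exact ⟨k', h1, by simp [runExecution, h2], by simp [runExecution, h2]⟩

theorem exists_invokes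
    (hf : (oneShot A U o).Fair (Tracked.initial A) ev Q) {p : Fin n} (hp : p ∈ Q) (hU : p ∈ U) :
    ∃ k, (runExecution h).Invokes k (.inl p) o := by
  obtain ⟨k, -, hk⟩ := hf.occurs 0 (p, .invoke o) hp
    ⟨trivial, fun o' h => by cases h; exact ⟨rfl, hU, rfl⟩⟩
  exact ⟨k, by simp [runExecution_invokes_iff, hk]⟩

end Runs

/-! ### Weights -/

theorem sum_update_add (w : Fin n → ℝ) (s : Fin n) (x : ℝ) (F : Finset (Fin n)) :
    ∑ i ∈ F, Function.update w s (w s + x) i = ∑ i ∈ F, w i + if s ∈ F then x else 0 := by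
  have : ∀ i, Function.update w s (w s + x) i = w i + if s = i then x else 0 := by
    intro i
    by_cases h : i = s
    · subst h; simp
    · simp [h, Ne.symm h]
  simp [this, Finset.sum_add_distrib]

/-- Some increase of the weight of `s` can be made once, but not twice. -/
theorem exists_increase {f : ℕ} (hf : 0 < f) (hfn : f < n) {w : Fin n → ℝ}
    (hw : IntegrityHolds f w) (s : Fin n) : ∃ Δ : ℝ, Δ ≠ 0 ∧
      IntegrityHolds f (Function.update w s (w s + Δ)) ∧
      ¬ IntegrityHolds f (Function.update w s (w s + (Δ + Δ))) := by
  obtain ⟨F₁, hF₁, -, hF₁c⟩ := Finset.exists_subsuperset_card_eq (Finset.subset_univ {s})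
    (n := f) (by simpa using Nat.succ_le_of_lt hf) (by simpa using hfn.le)
  obtain ⟨F₀, hF₀, hmin⟩ := Finset.exists_min_image
    ({F : Finset (Fin n) | F.card = f ∧ s ∈ F} : Finset (Finset (Fin n)))
    (fun F => (∑ i, w i) / 2 - ∑ i ∈ F, w i) ⟨F₁, by simpa [hF₁c] using hF₁⟩
  simp only [Finset.mem_filter, Finset.mem_univ, true_and] at hF₀ hmin
  have hpos := hw F₀ hF₀.1
  -- Let `m` be the least slack of an `f`-set containing `s`. Adding `x` to `w s` costs such a set
  -- `x / 2` of slack and helps all others. With `Δ = 3m/2`, one increase costs `3m/4 < m` and two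
  -- cost `3m/2 > m`.
  refine ⟨3 / 2 * ((∑ i, w i) / 2 - ∑ i ∈ F₀, w i), by nlinarith, fun F hF => ?_, fun h => ?_⟩
  · rw [sum_update_add, sum_update_add, if_pos (Finset.mem_univ s)]
    split_ifs with hs
    · have := hmin F ⟨hF, hs⟩
      linarith
    · have := hw F hF
      linarith
  · have := h F₀ hF₀.1
    rw [sum_update_add, sum_update_add, if_pos (Finset.mem_univ s), if_pos hF₀.2] at this
    linarith

/-! ### Weights created by one-shot requests -/

section OneShot

variable {U : Set (Fin n)} {s : Fin n} {Δ : ℝ} {ev : ℕ → Fin n × Input n A.Msg}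
  (h : (oneShot A U (.reassign s Δ)).IsRun (Tracked.initial A) ev)

/-- The invocations that are completed at time `t`. -/
def completedInvocations (E : Execution A) (X : Outcome) (o : Op n) (t : ℝ) : Set ℕ :=
  {k | (∃ p, E.Invokes k p o) ∧ X.completion k ≤ (t : WithTop ℝ)}

/-- Every request targets `s` and each server makes at most one, so distinct requests create changes
with distinct issuers and no summand is lost in the set of changes. -/
theorem weightAt_runExecution (w : Fin n → ℝ) (X : Outcome) (t : ℝ) :
    weightAt (runExecution h) w X t = Function.update w s
      (w s + ∑ᶠ k ∈ completedInvocations (runExecution h) X (.reassign s Δ) t, X.weight k) := by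
  set E := runExecution h with hE
  set K := completedInvocations E X (.reassign s Δ) t with hK
  have hinj : ∀ k ∈ K, ∀ k' ∈ K, E.actor k = E.actor k' → k = k' := by
    rintro k ⟨⟨p, hp⟩, -⟩ k' ⟨⟨p', hp'⟩, -⟩ hkk
    rw [hp.1, hp'.1] at hkk
    subst hkk
    obtain ⟨-, i, -, rfl⟩ := runExecution_invokes_eq h hp
    exact runExecution_invokes_unique h hp hp'
  have hfin : K.Finite := by
    refine Set.Finite.of_finite_image (f := fun k => (ev k).1) (Set.toFinite _) ?_
    intro k hk k' hk' hkk
    exact hinj k hk k' hk' (congrArg Sum.inl hkk)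
  funext i
  by_cases hi : i = s
  · subst hi
    have hset : completedChanges E w X i t = insert ⟨.inl i, 1, i, w i⟩
        ((fun k => (⟨E.actor k, E.counter k, i, X.weight k⟩ : Change n)) '' K) := by
      ext c
      simp only [completedChanges, Set.mem_ofPred_eq, Set.mem_insert_iff, Set.mem_image]
      refine or_congr_right ⟨?_, ?_⟩
      · rintro ⟨k, p, Δ', hk, hc, rfl⟩
        obtain ⟨ho, -⟩ := runExecution_invokes_eq h hk
        exact ⟨k, ⟨⟨p, ho ▸ hk⟩, hc⟩, by rw [hk.1]⟩
      · rintro ⟨k, ⟨⟨p, hk⟩, hc⟩, rfl⟩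
        exact ⟨k, p, Δ, hk, hc, by rw [hk.1]⟩
    rw [weightAt, hset, finsum_mem_insert _ _ (hfin.image _), finsum_mem_image, Function.update_self]
    · intro k hk k' hk' hkk
      exact hinj k hk k' hk' (congrArg Change.issuer hkk)
    -- The initial change has counter `1`, whereas requests have counters at least `2`.
    · rintro ⟨k, -, hk⟩
      have h1 := congrArg Change.counter hk
      simp only [Execution.counter] at h1
      omega
  · have hset : completedChanges E w X i t = {⟨.inl i, 1, i, w i⟩} := by
      ext c
      simp only [completedChanges, Set.mem_ofPred_eq, Set.mem_singleton_iff, or_iff_left_iff_imp]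
      rintro ⟨k, p, Δ', hk, -, -⟩
      obtain ⟨ho, -⟩ := runExecution_invokes_eq h hk
      cases ho
      exact (hi rfl).elim
    rw [weightAt, hset, finsum_mem_singleton, Function.update_of_ne hi]

variable {f : ℕ} {w : Fin n → ℝ} {X : Outcome}

open Classical in
theorem weight_eq_ite (hX : MeetsSpec (runExecution h) f w X) {k : ℕ} {p : Proc n}
    (hk : (runExecution h).Invokes k p (.reassign s Δ)) {τ : ℝ} (hτ : X.completion k = τ) :
    X.weight k = if IntegrityHolds f (Function.update w s (w s +
      ((∑ᶠ j ∈ completedInvocations (runExecution h) X (.reassign s Δ) τ, X.weight j) -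
        X.weight k + Δ))) then Δ else 0 := by
  have h1 := hX.validity_one k p s Δ hk τ hτ
  rw [weightAt_runExecution, Function.update_idem, Function.update_self] at h1
  have h2 : ∀ x : ℝ, w s + (x - X.weight k + Δ) = w s + x - X.weight k + Δ := fun x => by ring
  rw [h2]
  exact h1

theorem weight_eq_of_forall_invokes (hX : MeetsSpec (runExecution h) f w X)
    (hΔ : IntegrityHolds f (Function.update w s (w s + Δ))) {k : ℕ} {p : Proc n}
    (hk : (runExecution h).Invokes k p (.reassign s Δ)) (hc : X.completion k ≠ ⊤)
    (hp : ∀ k' p', (runExecution h).Invokes k' p' (.reassign s Δ) → k' = k) :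
    X.weight k = Δ := by
  obtain ⟨τ, hτ⟩ := WithTop.ne_top_iff_exists.1 hc
  have hset : completedInvocations (runExecution h) X (.reassign s Δ) τ = {k} := by
    ext k'
    constructor
    · rintro ⟨⟨p', h1⟩, -⟩
      exact hp k' p' h1
    · rintro rfl
      exact ⟨⟨p, hk⟩, hτ.ge⟩
  have h1 := weight_eq_ite h hX hk hτ.symm
  rwa [hset, finsum_mem_singleton, sub_self, zero_add, if_pos hΔ] at h1

/-- At `τ₁` both changes exist, so request `k₁` is tested with weight `w s + X.weight k₀ + Δ`: it
succeeds if `k₀` got `0` and fails if `k₀` got `Δ`. -/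
theorem weight_ne_zero_iff_of_le (hX : MeetsSpec (runExecution h) f w X) (hΔ₀ : Δ ≠ 0)
    (hΔ : IntegrityHolds f (Function.update w s (w s + Δ)))
    (hΔΔ : ¬ IntegrityHolds f (Function.update w s (w s + (Δ + Δ)))) {k₀ k₁ : ℕ} {p₀ p₁ : Proc n}
    (hne : p₀ ≠ p₁) (h₀ : (runExecution h).Invokes k₀ p₀ (.reassign s Δ))
    (h₁ : (runExecution h).Invokes k₁ p₁ (.reassign s Δ))
    (hall : ∀ k p, (runExecution h).Invokes k p (.reassign s Δ) → k = k₀ ∨ k = k₁)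
    {τ₀ τ₁ : ℝ} (hτ₀ : X.completion k₀ = τ₀) (hτ₁ : X.completion k₁ = τ₁) (hτ : τ₀ ≤ τ₁) :
    X.weight k₀ ≠ 0 ↔ X.weight k₁ = 0 := by
  have hk : k₀ ≠ k₁ := by
    rintro rfl
    exact hne (h₀.1.symm.trans h₁.1)
  have hset : ∀ t : ℝ, τ₁ ≤ t →
      completedInvocations (runExecution h) X (.reassign s Δ) t = {k₀, k₁} := by
    intro t ht
    ext k
    constructor
    · rintro ⟨⟨p, hp⟩, -⟩
      exact hall k p hp
    · rintro (rfl | rfl)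
      · exact ⟨⟨_, h₀⟩, by rw [hτ₀]; exact_mod_cast hτ.trans ht⟩
      · exact ⟨⟨_, h₁⟩, by rw [hτ₁]; exact_mod_cast ht⟩
  have e₀ := weight_eq_ite h hX h₀ hτ₀
  have e₁ := weight_eq_ite h hX h₁ hτ₁
  rw [hset τ₁ le_rfl, finsum_mem_pair hk, add_sub_cancel_right] at e₁
  -- In a tie each request is tested against the other's change, which still excludes two successes
  -- or two failures. Otherwise `k₀` is tested alone and gets `Δ`.
  rcases hτ.eq_or_lt with rfl | hlt
  · rw [hset τ₀ le_rfl, finsum_mem_pair hk, add_sub_cancel_left] at e₀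
    constructor
    · intro hne0
      have : X.weight k₀ = Δ := by
        by_contra hc
        split_ifs at e₀ <;> contradiction
      rwa [this, if_neg hΔΔ] at e₁
    · intro h10 h00
      rw [h00, zero_add, if_pos hΔ] at e₁
      exact hΔ₀ (e₁.symm.trans h10)
  · have hs₀ : completedInvocations (runExecution h) X (.reassign s Δ) τ₀ = {k₀} := by
      ext k
      constructor
      · rintro ⟨⟨p, hp⟩, hc⟩
        rcases hall k p hp with rfl | rfl
        · rfl
        · rw [hτ₁] at hc
          exact absurd (by exact_mod_cast hc) hlt.not_ge
      · rintro rfl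
        exact ⟨⟨_, h₀⟩, hτ₀.le⟩
    rw [hs₀, finsum_mem_singleton, sub_self, zero_add, if_pos hΔ] at e₀
    rw [e₀, if_neg hΔΔ] at e₁
    simp [e₀, e₁, hΔ₀]

/-- If both servers invoke `reassign(s, Δ)`, exactly one of the created changes has a nonzero
weight. -/
theorem weight_ne_zero_iff (hX : MeetsSpec (runExecution h) f w X) (hΔ₀ : Δ ≠ 0)
    (hΔ : IntegrityHolds f (Function.update w s (w s + Δ)))
    (hΔΔ : ¬ IntegrityHolds f (Function.update w s (w s + (Δ + Δ)))) {k₀ k₁ : ℕ} {p₀ p₁ : Proc n}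
    (hne : p₀ ≠ p₁) (h₀ : (runExecution h).Invokes k₀ p₀ (.reassign s Δ))
    (h₁ : (runExecution h).Invokes k₁ p₁ (.reassign s Δ))
    (hall : ∀ k p, (runExecution h).Invokes k p (.reassign s Δ) → k = k₀ ∨ k = k₁)
    (hc₀ : X.completion k₀ ≠ ⊤) (hc₁ : X.completion k₁ ≠ ⊤) :
    X.weight k₀ ≠ 0 ↔ X.weight k₁ = 0 := by
  obtain ⟨τ₀, hτ₀⟩ := WithTop.ne_top_iff_exists.1 hc₀
  obtain ⟨τ₁, hτ₁⟩ := WithTop.ne_top_iff_exists.1 hc₁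
  rcases le_total τ₀ τ₁ with hle | hle
  · exact weight_ne_zero_iff_of_le h hX hΔ₀ hΔ hΔΔ hne h₀ h₁ hall hτ₀.symm hτ₁.symm hle
  · have := weight_ne_zero_iff_of_le h hX hΔ₀ hΔ hΔΔ hne.symm h₁ h₀
      (fun k p hk => (hall k p hk).symm) hτ₁.symm hτ₀.symm hle
    tauto

end OneShot

/-! ### The winner of two competing requests -/

/-- Server `p₀` wins (`b = true`) if it gets a nonzero change, or if `p₁` gets a zero change; it
loses (`b = false`) if it gets a zero change, or if `p₁` gets a nonzero change. -/
def Decided (p₀ p₁ : Fin n) (c : Tracked A) (b : Bool) : Prop :=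
  (∃ ch, (c.record p₀).2 = some (.complete ch) ∧ (ch.weight ≠ 0 ↔ b = true)) ∨
    ∃ ch, (c.record p₁).2 = some (.complete ch) ∧ (ch.weight = 0 ↔ b = true)

theorem updateRecord_snd {M : Type v} {m : Bool × Option (Response n)} {r : Response n}
    (hm : m.2 = some r) (x : Input n M) (r' : Option (Response n)) :
    (updateRecord m x r').2 = some r := by
  unfold updateRecord
  split_ifs <;> simp [hm]

theorem Tracked.apply_record {c : Tracked A} {p : Fin n} {r : Response n}
    (hr : (c.record p).2 = some r) (e : Fin n × Input n A.Msg) :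
    ((c.apply e).record p).2 = some r := by
  by_cases hp : p = e.1
  · subst hp
    simpa [Tracked.apply] using updateRecord_snd hr _ _
  · rwa [Tracked.apply_record_of_ne hp]

theorem Decided.apply {p₀ p₁ : Fin n} {c : Tracked A} {b : Bool} (hd : Decided p₀ p₁ c b)
    (e : Fin n × Input n A.Msg) : Decided p₀ p₁ (c.apply e) b := by
  rcases hd with ⟨ch, h1, h2⟩ | ⟨ch, h1, h2⟩
  · exact .inl ⟨ch, Tracked.apply_record h1 e, h2⟩
  · exact .inr ⟨ch, Tracked.apply_record h1 e, h2⟩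

theorem not_solves {f : ℕ} (hf : 0 < f) {w : Fin n → ℝ} {s p₀ p₁ : Fin n} (hp : p₀ ≠ p₁) {Δ : ℝ}
    (hΔ₀ : Δ ≠ 0) (hΔ : IntegrityHolds f (Function.update w s (w s + Δ)))
    (hΔΔ : ¬ IntegrityHolds f (Function.update w s (w s + (Δ + Δ)))) : ¬ Solves A f w := by
  intro hA
  have : Nontrivial (Fin n) := ⟨p₀, p₁, hp⟩
  set T := oneShot A {p₀, p₁} (.reassign s Δ) with hT
  have hspec : ∀ {ev Q}, Qᶜ.Subsingleton → ∀ hr : T.IsRun (Tracked.initial A) ev,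
      T.Fair (Tracked.initial A) ev Q → ∃ X, MeetsSpec (runExecution hr) f w X :=
    fun hQ hr hfair => hA _ (runExecution_wellFormed hΔ₀ hr)
      (runExecution_admissible hr hfair hf hQ)
  -- A correct competitor gets the response that its change has been created.
  have hresp : ∀ {ev Q} (hr : T.IsRun (Tracked.initial A) ev),
      T.Fair (Tracked.initial A) ev Q → ∀ {X}, MeetsSpec (runExecution hr) f w X →
      ∀ {p : Fin n}, p ∈ Q → p ∈ ({p₀, p₁} : Set (Fin n)) →
      ∃ k, (runExecution hr).Invokes k (.inl p) (.reassign s Δ) ∧ X.completion k ≠ ⊤ ∧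
        ∃ j ch, ((T.conf (Tracked.initial A) ev j).record p).2 = some (.complete ch) ∧
          ch.weight = X.weight k := by
    intro ev Q hr hfair X hX p hpQ hpU
    obtain ⟨k, hk⟩ := exists_invokes hr hfair hpQ hpU
    obtain ⟨hc, j, ch, hj⟩ := hX.liveness_reassign k _ s Δ hk
      ((runExecution_correct_iff hr hfair).2 ⟨p, hpQ, rfl⟩)
    refine ⟨k, hk, hc, j + 1, ch, record_of_respondsAt hr hk hj, ?_⟩
    have h1 := (hX.complete_message k _ s Δ hk j _ hj).2
    simp only [Response.complete.injEq] at h1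
    rw [h1]
  -- With `q` crashed from the start, `p` is the only requester and wins; exchanging the roles
  -- yields bivalence.
  have hsilent : ∀ p ∈ ({p₀, p₁} : Set (Fin n)), ∀ q ∈ ({p₀, p₁} : Set (Fin n)), p ≠ q →
      ∃ σ ch, T.Valid (Tracked.initial A) σ ∧
        ((T.exec (Tracked.initial A) σ).record p).2 = some (.complete ch) ∧ ch.weight ≠ 0 := by
    intro p hpU q hqU hpq
    obtain ⟨ev, hr, hfair, hQ⟩ := EventSystem.exists_silent_run (T := T) (Q := {q}ᶜ) ⟨p, hpq⟩
      (Tracked.initial A)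
    obtain ⟨X, hX⟩ := hspec (by simp) hr hfair
    obtain ⟨k, hk, hc, j, ch, hj, hch⟩ := hresp hr hfair hX (p := p) hpq hpU
    refine ⟨_, ch, hr.valid j, by rwa [EventSystem.exec_map_range], ?_⟩
    rw [hch, weight_eq_of_forall_invokes hr hX hΔ hk hc fun k' p' hk' => ?_]
    · exact hΔ₀
    · obtain ⟨-, i, hi, rfl⟩ := runExecution_invokes_eq hr hk'
      have hiq : i ≠ q := by
        have h1 := ((runExecution_invokes_iff hr).1 hk').1
        rw [Sum.inl.injEq] at h1
        exact h1 ▸ hQ k'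
      obtain rfl : i = p := by
        rcases hi with rfl | rfl <;> rcases hpU with rfl | rfl <;> rcases hqU with rfl | rfl <;>
          first | rfl | exact (hpq rfl).elim | exact (hiq rfl).elim
      exact runExecution_invokes_unique hr hk' hk
  refine EventSystem.fischer_lynch_paterson (T := T) (dec := Decided p₀ p₁)
    (C₀ := Tracked.initial A) (fun _ hd => hd.apply _) ?_ ?_ ?_
  · rintro σ hσ ⟨ht, hff⟩
    -- Agreement: an outcome belongs to a whole execution, so `σ` is extended to a crash-free one.
    -- There both requests complete and exactly one wins, and every change recorded after `σ` has
    -- the weight that this outcome assigns.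
    obtain ⟨ev', hr', hfair', -⟩ := EventSystem.exists_silent_run (T := T) Set.univ_nonempty
      (T.exec (Tracked.initial A) σ)
    obtain ⟨ev, hr, hfair, hconf⟩ := EventSystem.exists_prepend hσ hr' hfair'
    have hC := hconf 0
    rw [EventSystem.conf_zero] at hC
    rw [← hC] at ht hff
    obtain ⟨X, hX⟩ := hspec (by simp) hr hfair
    obtain ⟨k₀, hk₀, hc₀, -⟩ := hresp hr hfair hX (Set.mem_univ p₀) (by simp)
    obtain ⟨k₁, hk₁, hc₁, -⟩ := hresp hr hfair hX (Set.mem_univ p₁) (by simp)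
    have hiff := weight_ne_zero_iff hr hX hΔ₀ hΔ hΔΔ (by simpa using hp) hk₀ hk₁
      (fun k p hk => by
        obtain ⟨-, i, hi, rfl⟩ := runExecution_invokes_eq hr hk
        rcases hi with rfl | rfl
        · exact .inl (runExecution_invokes_unique hr hk hk₀)
        · exact .inr (runExecution_invokes_unique hr hk hk₁)) hc₀ hc₁
    have hrec : ∀ {p : Fin n} {k : ℕ} {ch : Change n},
        (runExecution hr).Invokes k (.inl p) (.reassign s Δ) →
        ((T.conf (Tracked.initial A) ev (σ.length + 0)).record p).2 = some (.complete ch) →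
        ch.weight = X.weight k := by
      intro p k ch hk hrec
      obtain ⟨j, hj, i, hi⟩ := exists_respondsAt_of_record hr hrec
      obtain rfl := runExecution_invokes_unique hr hj hk
      have h1 := (hX.complete_message j _ s Δ hk i _ hi).2
      simp only [Response.complete.injEq] at h1
      rw [h1]
    have key : ∀ b, Decided p₀ p₁ (T.conf (Tracked.initial A) ev (σ.length + 0)) b →
        (X.weight k₀ ≠ 0 ↔ b = true) := by
      rintro b (⟨ch, h1, h2⟩ | ⟨ch, h1, h2⟩)
      · rwa [hrec hk₀ h1] at h2
      · rw [hrec hk₁ h1] at h2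
        exact hiff.trans h2
    exact absurd ((key true ht).2 rfl) (fun hne => by simpa using (key false hff).1 hne)
  · intro ev Q hQ hr hfair
    obtain ⟨X, hX⟩ := hspec hQ hr hfair
    by_cases hp₀ : p₀ ∈ Q
    · obtain ⟨k, -, -, j, ch, hj, -⟩ := hresp hr hfair hX hp₀ (by simp)
      by_cases hch : ch.weight = 0
      · exact ⟨j, false, .inl ⟨ch, hj, by simp [hch]⟩⟩
      · exact ⟨j, true, .inl ⟨ch, hj, by simp [hch]⟩⟩
    -- At most one server is outside `Q`, so the other competitor is answered, and its change also
    -- identifies the winner.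
    · have hp₁ : p₁ ∈ Q := by
        by_contra hp₁
        exact hp (hQ hp₀ hp₁)
      obtain ⟨k, -, -, j, ch, hj, -⟩ := hresp hr hfair hX hp₁ (by simp)
      by_cases hch : ch.weight = 0
      · exact ⟨j, true, .inr ⟨ch, hj, by simp [hch]⟩⟩
      · exact ⟨j, false, .inr ⟨ch, hj, by simp [hch]⟩⟩
  · rintro (_ | _)
    · obtain ⟨σ, ch, h1, h2, h3⟩ := hsilent p₁ (by simp) p₀ (by simp) hp.symm
      exact ⟨σ, h1, .inr ⟨ch, h2, by simp [h3]⟩⟩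
    · obtain ⟨σ, ch, h1, h2, h3⟩ := hsilent p₀ (by simp) p₁ (by simp) hp
      exact ⟨σ, h1, .inl ⟨ch, h2, by simp [h3]⟩⟩

end WeightReassignment

theorem mainTheorem1 (n f : ℕ) (hf : 0 < f) (hfn : f < n) (w : Fin n → ℝ)
    (hw : WeightReassignment.IntegrityHolds f w) :
    ¬ ∃ A : WeightReassignment.Algorithm.{u, v} n, WeightReassignment.Solves A f w := by
  rintro ⟨A, hA⟩
  -- The choice of target is arbitrary; it may itself be one of the competitors.
  obtain ⟨Δ, h1, h2, h3⟩ := WeightReassignment.exists_increase hf hfn hw ⟨0, by omega⟩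
  exact WeightReassignment.not_solves hf (p₀ := ⟨0, by omega⟩) (p₁ := ⟨1, by omega⟩)
    (by simp) h1 h2 h3 hA
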